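/- Let $V$ be a finite set of discrete random variables, each with finitely many values, let $C\in V$ be the class attribute and $F=V\setminus\{C\}$ the set of features. Let $G$ be a directed acyclic graph on $V$ and $P$ the joint distribution of $V$, and suppose that $\langle V,G,P\rangle$ is a Bayesian network, i.e. every node is conditionally independent of any set of its non-descendants given its parents (Markov condition), and that $P$ is faithful to $G$: every conditional independence $V_i\perp V_j\mid S$ (with $V_i\neq V_j$ and $S\subseteq V\setminus\{V_i,V_j\}$) that holds in $P$ is entailed by $G$ and the Markov condition, i.e. holds in every finite discrete joint distribution that satisfies the Markov condition for $G$. Let $MB(C)\subseteq F$ consist of the parents of $C$, the children of $C$ and the other parents of the children of $C$. Inter-IAMB, run with the exact values of the (conditional) mutual information $I$ under $P$, starts with $S=\emptyset$ and repeats the following: (forward) if $I(X;C\mid S)=0$ for all $X\in F\setminus S$, stop and output $S$; otherwise add to $S$ a feature $X\in F\setminus S$ that maximizes $I(X;C\mid S)$; (backward) immediately afterwards, as long as some $Y\in S$ satisfies $I(C;Y\mid S\setminus\{Y\})=0$, remove such a $Y$ from $S$, until $I(C;Y\mid S\setminus\{Y\})>0$ for all $Y\in S$. Ties in the choice of $X$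 and $Y$ are broken arbitrarily. Then every run of Inter-IAMB stops after finitely many steps, and its output is $MB(C)$. Moreover $MB(C)$ is the optimal set $S^*=\arg\max_{S\subseteq F} I(C;S)$, in the sense that it maximizes $I(C;S)$ over all $S\subseteq F$ and is contained in every other maximizer. -/

import Mathlib

noncomputable section

namespace FeatureSelection

/-! ### Discrete probability: conditional independence and mutual information -/

section Discrete

variable {Ω A B D : Type*}

/-- The probability `P(E)` of an event, as a real number. -/
def prob (p : PMF Ω) (E : Set Ω) : ℝ := (p.toOuterMeasure E).toReal

/-- The conditional probability `P(E | H) = P(E ∩ H) / P(H)`. -/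
def condProb (p : PMF Ω) (E H : Set Ω) : ℝ := prob p (E ∩ H) / prob p H

/-- Conditional independence of random variables, `P(X, Y | Z) = P(X | Z) P(Y | Z)`,
for all values `z` of `Z` of positive probability. -/
def CondIndep (p : PMF Ω) (X : Ω → A) (Y : Ω → B) (Z : Ω → D) : Prop :=
  ∀ x y z, 0 < prob p (Z ⁻¹' {z}) →
    condProb p (X ⁻¹' {x} ∩ Y ⁻¹' {y}) (Z ⁻¹' {z}) =
      condProb p (X ⁻¹' {x}) (Z ⁻¹' {z}) * condProb p (Y ⁻¹' {y}) (Z ⁻¹' {z})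

/-- Mutual information `I(X; Y) = ∑ P(x, y) log (P(x, y) / (P(x) P(y)))`
(terms with `P(x, y) = 0` vanish, as `0 * _ = 0`). -/
def mutualInfo [Fintype A] [Fintype B] (p : PMF Ω) (X : Ω → A) (Y : Ω → B) : ℝ :=
  ∑ x, ∑ y, prob p (X ⁻¹' {x} ∩ Y ⁻¹' {y}) *
    Real.log (prob p (X ⁻¹' {x} ∩ Y ⁻¹' {y}) / (prob p (X ⁻¹' {x}) * prob p (Y ⁻¹' {y})))

/-- Conditional mutual information
`I(X; Y | Z) = ∑ P(z) ∑ P(x, y | z) log (P(x, y | z) / (P(x | z) P(y | z)))`. -/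
def condMutualInfo [Fintype A] [Fintype B] [Fintype D]
    (p : PMF Ω) (X : Ω → A) (Y : Ω → B) (Z : Ω → D) : ℝ :=
  ∑ z, prob p (Z ⁻¹' {z}) * ∑ x, ∑ y,
    condProb p (X ⁻¹' {x} ∩ Y ⁻¹' {y}) (Z ⁻¹' {z}) *
      Real.log (condProb p (X ⁻¹' {x} ∩ Y ⁻¹' {y}) (Z ⁻¹' {z}) /
        (condProb p (X ⁻¹' {x}) (Z ⁻¹' {z}) * condProb p (Y ⁻¹' {y}) (Z ⁻¹' {z})))

end Discrete

/-! ### Bayesian networks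

The variables are indexed by `V`; variable `i` takes values in `α i`, and their joint distribution
is a probability mass function on `∀ i, α i`. The subvector of the variables in `S : Finset V` is
`S.restrict`, and variable `i` is the coordinate map `fun ω => ω i`. -/

section Network

variable {V : Type*}

/-- The directed graph `G` has no directed cycle (in particular no loop). -/
def IsAcyclic (G : Digraph V) : Prop := ∀ v, ¬ Relation.TransGen G.Adj v v

/-- `w` is a descendant of `v`: there is a directed path of positive length from `v` to `w`. -/
def IsDescendant (G : Digraph V) (v w : V) : Prop := Relation.TransGen G.Adj v w

open Classical in
/-- The set of parents of `v`. -/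
def parents [Fintype V] (G : Digraph V) (v : V) : Finset V :=
  Finset.univ.filter fun u => G.Adj u v

open Classical in
/-- The Markov blanket of `C`: its parents, its children, and its spouses
(the other parents of its children). -/
def markovBlanket [Fintype V] (G : Digraph V) (C : V) : Finset V :=
  Finset.univ.filter fun v =>
    v ≠ C ∧ (G.Adj v C ∨ G.Adj C v ∨ ∃ w, G.Adj C w ∧ G.Adj v w)

/-- Markov condition: every node is independent of any set of its non-descendants (other than
itself) given its parents. -/
def MarkovCondition [Fintype V] {α : V → Type*} (G : Digraph V) (p : PMF (∀ i, α i)) : Prop :=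
  ∀ (v : V) (T : Finset V), (∀ w ∈ T, w ≠ v ∧ ¬ IsDescendant G v w) →
    CondIndep p (fun ω => ω v) T.restrict (parents G v).restrict

/-- `⟨V, G, P⟩` is a Bayesian network: `G` is a DAG and `P` satisfies the Markov condition. -/
structure IsBayesianNetwork [Fintype V] {α : V → Type*} (G : Digraph V)
    (p : PMF (∀ i, α i)) : Prop where
  acyclic : IsAcyclic G
  markov : MarkovCondition G p

/-- The conditional independence of `i` and `j` given `S` is entailed by `G` and the Markov
condition: it holds in every finite discrete joint distribution, with arbitrary value sets,
that satisfies the Markov condition for `G`. -/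
def Entailed [Fintype V] (G : Digraph V) (i j : V) (S : Finset V) : Prop :=
  ∀ (β : V → Type) [∀ v, Fintype (β v)] (q : PMF (∀ v, β v)), MarkovCondition G q →
    CondIndep q (fun ω => ω i) (fun ω => ω j) S.restrict

/-- Faithfulness: every conditional independence `i ⊥ j | S` present in `P`, for distinct variables
`i`, `j` and `S ⊆ V \ {i, j}`, is entailed by `G` and the Markov condition. -/
def Faithful [Fintype V] {α : V → Type*} (G : Digraph V) (p : PMF (∀ i, α i)) : Prop :=
  ∀ (i j : V) (S : Finset V), i ≠ j → i ∉ S → j ∉ S →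
    CondIndep p (fun ω => ω i) (fun ω => ω j) S.restrict → Entailed G i j S

end Network

/-! ### Feature selection and Inter-IAMB

`C` is the class attribute, and the features are all the other variables. -/

section Selection

variable {V : Type*} [DecidableEq V] {α : V → Type*} [∀ i, Fintype (α i)]

/-- `I(C; S)`, the mutual information of the class attribute and the feature vector `S`. -/
def classInfo (p : PMF (∀ i, α i)) (C : V) (S : Finset V) : ℝ :=
  mutualInfo p (fun ω => ω C) S.restrict

/-- `I(X; C | S)`, the conditional mutual information of a feature `X` and the class attribute
given the feature vector `S`. -/
def relevance (p : PMF (∀ i, α i)) (C X : V) (S : Finset V) : ℝ :=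
  condMutualInfo p (fun ω => ω X) (fun ω => ω C) S.restrict

/-- `argmax I(C; S)` over the sets `S` of features. -/
def optimalSets (p : PMF (∀ i, α i)) (C : V) : Set (Finset V) :=
  {S | C ∉ S ∧ ∀ T : Finset V, C ∉ T → classInfo p C T ≤ classInfo p C S}

/-- What the algorithm is about to do. -/
inductive Phase
  | forward
  | backward

/-- One step of Inter-IAMB (with exact values of the mutual information) on pairs
(current phase, currently selected set `S`). Ties are broken arbitrarily. -/
inductive InterIAMBStep (p : PMF (∀ i, α i)) (C : V) :
    Phase × Finset V → Phase × Finset V → Prop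
  /-- Forward: add a feature `X ∉ S` that maximizes `I(X; C | S)`, if this value is positive;
  the backward phase follows immediately. -/
  | add (S : Finset V) (X : V) (hXC : X ≠ C) (hXS : X ∉ S)
      (hmax : ∀ Y, Y ≠ C → Y ∉ S → relevance p C Y S ≤ relevance p C X S)
      (hpos : 0 < relevance p C X S) :
      InterIAMBStep p C (Phase.forward, S) (Phase.backward, insert X S)
  /-- Backward: remove some `Y ∈ S` with `I(Y; C | S \ {Y}) = 0`. -/
  | remove (S : Finset V) (Y : V) (hY : Y ∈ S) (hzero : relevance p C Y (S.erase Y) = 0) :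
      InterIAMBStep p C (Phase.backward, S) (Phase.backward, S.erase Y)
  /-- Once `I(Y; C | S \ {Y}) > 0` for all `Y ∈ S`, return to the forward phase. -/
  | resume (S : Finset V) (hpos : ∀ Y ∈ S, 0 < relevance p C Y (S.erase Y)) :
      InterIAMBStep p C (Phase.backward, S) (Phase.forward, S)

/-- The algorithm starts in the forward phase with the empty set. -/
def interIAMBStart : Phase × Finset V := (Phase.forward, ∅)

/-- The state `s` is reached by some run of Inter-IAMB. -/
def InterIAMBReachable (p : PMF (∀ i, α i)) (C : V) (s : Phase × Finset V) : Prop :=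
  Relation.ReflTransGen (InterIAMBStep p C) interIAMBStart s

/-- The stopping criterion: in the forward phase, `I(X; C | S) = 0` for all features `X ∉ S`. -/
def InterIAMBHalted (p : PMF (∀ i, α i)) (C : V) (s : Phase × Finset V) : Prop :=
  s.1 = Phase.forward ∧ ∀ X, X ≠ C → X ∉ s.2 → relevance p C X s.2 = 0

/-- `S` is the output of some run of Inter-IAMB. -/
def InterIAMBOutput (p : PMF (∀ i, α i)) (C : V) (S : Finset V) : Prop :=
  InterIAMBReachable p C (Phase.forward, S) ∧ InterIAMBHalted p C (Phase.forward, S)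

/-- Every run of Inter-IAMB, however ties are broken, stops after finitely many steps, and it never
gets stuck before the stopping criterion holds. -/
def InterIAMBTerminates (p : PMF (∀ i, α i)) (C : V) : Prop :=
  (¬ ∃ run : ℕ → Phase × Finset V, run 0 = interIAMBStart ∧
      ∀ k, InterIAMBStep p C (run k) (run (k + 1))) ∧
  ∀ s, InterIAMBReachable p C s → ¬ InterIAMBHalted p C s → ∃ t, InterIAMBStep p C s t

end Selection

end FeatureSelection

end

/-!
The argument splits into a qualitative half, about conditional independences in the network, and a
quantitative half, about the information `I(C; S)`.

*Blanket.* The Markov condition makes the joint distribution the product of the local factors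
`P(v | parents of v)` (`prob_cylinder_eq_prod`, by removing sinks from ancestral sets; no
positivity of the distribution is needed). The factors that involve `C` mention only `C` and
its Markov blanket, so `C` is independent of every other variable given any set of features
that contains the blanket (`IsBayesianNetwork.condIndep_of_markovBlanket_subset`).

*Necessity.* Conversely, let `S` be a set of features such that every feature outside `S` is
independent of `C` given `S`. By faithfulness these independences hold in every distribution that is
Markov for `G`. A model that copies a fair bit along one edge shows that `S` contains all parents
and children of `C`; then a common child of `C` and a spouse lies in `S`, and a model in which this
child is the sum modulo `2` of two fair bits shows that `S` contains the spouse
(`markovBlanket_subset_of_relevance_eq_zero`). Only these two kinds of models are needed, so neither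
d-separation nor the composition or intersection properties enter.

*Information.* By Gibbs' inequality the conditional mutual information is nonnegative and vanishes
exactly for conditional independence, and `I(C; S ∪ {X}) = I(C; S) + I(X; C | S)`. Hence an addition
increases `I(C; S)` strictly and a removal preserves it, and there are only finitely many states:
every run stops (`wellFounded_interIAMBStep`). When it stops, nothing outside `S` is relevant, so `S`
contains the blanket, and nothing in `S` is redundant, so `S` contains nothing else. By the chain
rule again, the blanket maximizes `I(C; S)`, and for any other maximizer nothing outside of it is
relevant, so it contains the blanket.
-/

namespace FeatureSelection

/-! ### Probabilities on a finite sample space -/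

section Prob

variable {Ω Ω' A B D : Type*}

lemma prob_nonneg (p : PMF Ω) (E : Set Ω) : 0 ≤ prob p E := ENNReal.toReal_nonneg

lemma toOuterMeasure_ne_top (p : PMF Ω) (E : Set Ω) : p.toOuterMeasure E ≠ ⊤ := by
  refine ne_top_of_le_ne_top ENNReal.one_ne_top ?_
  rw [PMF.toOuterMeasure_apply, ← p.tsum_coe]
  exact ENNReal.tsum_le_tsum fun a => Set.indicator_le_self _ _ _

lemma prob_mono (p : PMF Ω) {E H : Set Ω} (h : E ⊆ H) : prob p E ≤ prob p H :=
  ENNReal.toReal_mono (toOuterMeasure_ne_top p H) (MeasureTheory.measure_mono h)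

lemma prob_univ {Ω : Type*} (p : PMF Ω) : prob p Set.univ = 1 := by
  rw [prob, (p.toOuterMeasure_apply_eq_one_iff _).2 (Set.subset_univ _), ENNReal.toReal_one]

lemma prob_map (p : PMF Ω) (f : Ω → Ω') (E : Set Ω') : prob (p.map f) E = prob p (f ⁻¹' E) := by
  rw [prob, prob, PMF.toOuterMeasure_map_apply]

lemma condIndep_map (p : PMF Ω) (f : Ω → Ω') (X : Ω' → A) (Y : Ω' → B) (Z : Ω' → D) :
    CondIndep (p.map f) X Y Z ↔ CondIndep p (X ∘ f) (Y ∘ f) (Z ∘ f) := by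
  simp only [CondIndep, condProb, prob_map, Set.preimage_inter, Set.preimage_comp]

lemma CondIndep.symm {p : PMF Ω} {X : Ω → A} {Y : Ω → B} {Z : Ω → D} (h : CondIndep p X Y Z) :
    CondIndep p Y X Z := fun y x z hz => by
  rw [Set.inter_comm, h x y z hz, mul_comm]

/-- A random variable that is a function of `Z` is independent of everything given `Z`. -/
lemma condIndep_of_factorsThrough (p : PMF Ω) (X : Ω → A) (Y : Ω → B) (Z : Ω → D)
    (h : ∀ ω ω', Z ω = Z ω' → X ω = X ω') : CondIndep p X Y Z := by
  intro x y z hz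
  have hne : prob p (Z ⁻¹' {z}) ≠ 0 := hz.ne'
  by_cases hx : ∃ ω, Z ω = z ∧ X ω = x
  · obtain ⟨ω₀, h1, h2⟩ := hx
    have hsub : Z ⁻¹' {z} ⊆ X ⁻¹' {x} := fun ω hω => by
      simp only [Set.mem_preimage, Set.mem_singleton_iff] at hω ⊢
      rw [← h2]; exact h _ _ (hω.trans h1.symm)
    have e1 : X ⁻¹' {x} ∩ Y ⁻¹' {y} ∩ Z ⁻¹' {z} = Y ⁻¹' {y} ∩ Z ⁻¹' {z} := by
      ext ω; constructor
      · rintro ⟨⟨_, h⟩, h'⟩; exact ⟨h, h'⟩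
      · rintro ⟨h, h'⟩; exact ⟨⟨hsub h', h⟩, h'⟩
    rw [condProb, condProb, condProb, e1, Set.inter_eq_right.2 hsub, div_self hne, one_mul]
  · have e : X ⁻¹' {x} ∩ Z ⁻¹' {z} = ∅ := by
      ext ω
      simp only [Set.mem_inter_iff, Set.mem_preimage, Set.mem_singleton_iff, Set.mem_empty_iff_false,
        iff_false]
      exact fun h => hx ⟨ω, h.2, h.1⟩
    have e' : X ⁻¹' {x} ∩ Y ⁻¹' {y} ∩ Z ⁻¹' {z} = ∅ := by
      rw [Set.inter_right_comm, e, Set.empty_inter]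
    have h0 : prob p ∅ = 0 := by simp [prob]
    rw [condProb, condProb, e, e', h0, zero_div, zero_mul]

variable [Fintype Ω]

open Classical in
lemma prob_eq_sum (p : PMF Ω) (E : Set Ω) : prob p E = ∑ ω, if ω ∈ E then (p ω).toReal else 0 := by
  rw [prob, PMF.toOuterMeasure_apply_fintype, ENNReal.toReal_sum]
  · refine Finset.sum_congr rfl fun ω _ => ?_
    by_cases h : ω ∈ E <;> simp [h]
  · intro ω _
    by_cases h : ω ∈ E <;> simp [h, p.apply_ne_top]

lemma prob_pos_of_mem (p : PMF Ω) {ω : Ω} (hω : 0 < (p ω).toReal) {E : Set Ω} (h : ω ∈ E) :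
    0 < prob p E := by
  classical
  rw [prob_eq_sum]
  refine Finset.sum_pos' (fun i _ => ?_) ⟨ω, Finset.mem_univ _, by rwa [if_pos h]⟩
  split_ifs
  exacts [ENNReal.toReal_nonneg, le_rfl]

/-- The law of the unconscious statistician. -/
lemma sum_prob_mul [Fintype A] (p : PMF Ω) (X : Ω → A) (F : A → ℝ) :
    ∑ x, prob p (X ⁻¹' {x}) * F x = ∑ ω, (p ω).toReal * F (X ω) := by
  classical
  simp only [prob_eq_sum, Finset.sum_mul]
  rw [Finset.sum_comm]
  refine Finset.sum_congr rfl fun ω _ => ?_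
  rw [Finset.sum_eq_single (X ω)]
  · simp
  · intro b _ hb
    rw [if_neg (by simpa using hb.symm), zero_mul]
  · simp

lemma sum_prob_inter [Fintype A] (p : PMF Ω) (X : Ω → A) (E : Set Ω) :
    ∑ x, prob p (X ⁻¹' {x} ∩ E) = prob p E := by
  classical
  simp only [prob_eq_sum]
  rw [Finset.sum_comm]
  refine Finset.sum_congr rfl fun ω _ => ?_
  by_cases h : ω ∈ E <;> simp [h]

end Prob

/-! ### Conditional mutual information -/

section Information

variable {Ω A B D : Type*}

/-- One term of Gibbs' inequality. -/
lemma sub_le_mul_log_div {a b : ℝ} (ha : 0 ≤ a) (hb : 0 ≤ b) (hab : b = 0 → a = 0) :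
    a - b ≤ a * Real.log (a / b) ∧ (a * Real.log (a / b) = a - b → a = b) := by
  rcases ha.eq_or_lt with rfl | ha
  · simp only [zero_mul, zero_sub]
    exact ⟨by linarith, fun h => by linarith⟩
  have hb : 0 < b := hb.lt_of_ne fun h => ha.ne' (hab h.symm)
  have hlog : Real.log (a / b) = - Real.log (b / a) := by rw [← Real.log_inv, inv_div]
  have hba : a * (b / a) = b := by field_simp
  rw [hlog]
  refine ⟨?_, fun h => ?_⟩
  · nlinarith [Real.log_le_sub_one_of_pos (div_pos hb ha)]
  · by_contra hne
    have h1 : b / a ≠ 1 := fun h => hne ((div_eq_one_iff_eq ha.ne').1 h).symm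
    nlinarith [Real.log_lt_sub_one_of_pos (div_pos hb ha) h1]

/-- Gibbs' inequality for a joint distribution and the product of its marginals: the mutual
information is nonnegative, and vanishes only for a product. -/
lemma gibbs_marginals [Fintype A] [Fintype B] (a : A → B → ℝ) (ha : ∀ x y, 0 ≤ a x y)
    (r : A → ℝ) (s : B → ℝ) (hr : ∀ x, ∑ y, a x y = r x) (hs : ∀ y, ∑ x, a x y = s y)
    (h1 : ∑ x, r x = 1) :
    0 ≤ ∑ x, ∑ y, a x y * Real.log (a x y / (r x * s y)) ∧
      (∑ x, ∑ y, a x y * Real.log (a x y / (r x * s y)) = 0 → ∀ x y, a x y = r x * s y) := by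
  have hr0 : ∀ x, 0 ≤ r x := fun x => hr x ▸ Finset.sum_nonneg fun y _ => ha x y
  have hs0 : ∀ y, 0 ≤ s y := fun y => hs y ▸ Finset.sum_nonneg fun x _ => ha x y
  have h1' : ∑ y, s y = 1 := by
    simp only [← hs, ← h1, ← hr]; exact Finset.sum_comm
  have hterm := fun x y => sub_le_mul_log_div (ha x y) (mul_nonneg (hr0 x) (hs0 y)) (by
    intro h
    rcases mul_eq_zero.1 h with h | h
    · rw [← hr, Finset.sum_eq_zero_iff_of_nonneg fun y _ => ha x y] at h
      exact h y (Finset.mem_univ _)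
    · rw [← hs, Finset.sum_eq_zero_iff_of_nonneg fun x _ => ha x y] at h
      exact h x (Finset.mem_univ _))
  have hz : ∑ x, ∑ y, (a x y - r x * s y) = 0 := by
    simp only [Finset.sum_sub_distrib, hr, ← Finset.mul_sum, h1', mul_one, sub_self,
      Finset.sum_const_zero]
  have hnn : ∀ x y, 0 ≤ a x y * Real.log (a x y / (r x * s y)) - (a x y - r x * s y) :=
    fun x y => sub_nonneg.2 (hterm x y).1
  have hsum : ∑ x, ∑ y, a x y * Real.log (a x y / (r x * s y)) =
      ∑ x, ∑ y, (a x y * Real.log (a x y / (r x * s y)) - (a x y - r x * s y)) := by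
    simp only [Finset.sum_sub_distrib] at hz ⊢
    rw [hz, sub_zero]
  rw [hsum]
  refine ⟨Finset.sum_nonneg fun x _ => Finset.sum_nonneg fun y _ => hnn x y, fun h x y => ?_⟩
  rw [Finset.sum_eq_zero_iff_of_nonneg fun x _ => Finset.sum_nonneg fun y _ => hnn x y] at h
  have h' := h x (Finset.mem_univ _)
  rw [Finset.sum_eq_zero_iff_of_nonneg fun y _ => hnn x y] at h'
  exact (hterm x y).2 (sub_eq_zero.1 (h' y (Finset.mem_univ _)))

variable [Fintype Ω] [Fintype A] [Fintype B]

/-- Gibbs' inequality for the joint distribution of `X` and `Y` conditional on the event `H`. -/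
lemma condProb_gibbs (p : PMF Ω) (X : Ω → A) (Y : Ω → B) (H : Set Ω) (hH : 0 < prob p H) :
    0 ≤ ∑ x, ∑ y, condProb p (X ⁻¹' {x} ∩ Y ⁻¹' {y}) H *
      Real.log (condProb p (X ⁻¹' {x} ∩ Y ⁻¹' {y}) H /
        (condProb p (X ⁻¹' {x}) H * condProb p (Y ⁻¹' {y}) H)) ∧
    (∑ x, ∑ y, condProb p (X ⁻¹' {x} ∩ Y ⁻¹' {y}) H *
      Real.log (condProb p (X ⁻¹' {x} ∩ Y ⁻¹' {y}) H /
        (condProb p (X ⁻¹' {x}) H * condProb p (Y ⁻¹' {y}) H)) = 0 →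
      ∀ x y, condProb p (X ⁻¹' {x} ∩ Y ⁻¹' {y}) H =
        condProb p (X ⁻¹' {x}) H * condProb p (Y ⁻¹' {y}) H) := by
  refine gibbs_marginals (fun x y => condProb p (X ⁻¹' {x} ∩ Y ⁻¹' {y}) H)
    (fun x y => div_nonneg (prob_nonneg _ _) (prob_nonneg _ _))
    (fun x => condProb p (X ⁻¹' {x}) H) (fun y => condProb p (Y ⁻¹' {y}) H) ?_ ?_ ?_
  · intro x
    simp only [condProb, ← Finset.sum_div]
    congr 1
    rw [← sum_prob_inter p Y (X ⁻¹' {x} ∩ H)]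
    refine Finset.sum_congr rfl fun y _ => ?_
    rw [Set.inter_comm (X ⁻¹' {x}), Set.inter_assoc]
  · intro y
    simp only [condProb, ← Finset.sum_div]
    congr 1
    rw [← sum_prob_inter p X (Y ⁻¹' {y} ∩ H)]
    simp only [Set.inter_assoc]
  · simp only [condProb, ← Finset.sum_div, sum_prob_inter]
    exact div_self hH.ne'

lemma condMutualInfo_term_nonneg (p : PMF Ω) (X : Ω → A) (Y : Ω → B) (Z : Ω → D) (z : D) :
    0 ≤ prob p (Z ⁻¹' {z}) * ∑ x, ∑ y,
    condProb p (X ⁻¹' {x} ∩ Y ⁻¹' {y}) (Z ⁻¹' {z}) *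
      Real.log (condProb p (X ⁻¹' {x} ∩ Y ⁻¹' {y}) (Z ⁻¹' {z}) /
        (condProb p (X ⁻¹' {x}) (Z ⁻¹' {z}) * condProb p (Y ⁻¹' {y}) (Z ⁻¹' {z}))) := by
  rcases (prob_nonneg p (Z ⁻¹' {z})).eq_or_lt with h | h
  · rw [← h, zero_mul]
  · exact mul_nonneg h.le (condProb_gibbs p X Y _ h).1

variable [Fintype D]

lemma condMutualInfo_nonneg (p : PMF Ω) (X : Ω → A) (Y : Ω → B) (Z : Ω → D) :
    0 ≤ condMutualInfo p X Y Z :=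
  Finset.sum_nonneg fun z _ => condMutualInfo_term_nonneg p X Y Z z

lemma condMutualInfo_eq_zero_iff (p : PMF Ω) (X : Ω → A) (Y : Ω → B) (Z : Ω → D) :
    condMutualInfo p X Y Z = 0 ↔ CondIndep p X Y Z := by
  rw [condMutualInfo,
    Finset.sum_eq_zero_iff_of_nonneg fun z _ => condMutualInfo_term_nonneg p X Y Z z]
  constructor
  · intro h x y z hz
    exact (condProb_gibbs p X Y _ hz).2
      ((mul_eq_zero.1 (h z (Finset.mem_univ _))).resolve_left hz.ne') x y
  · intro h z _
    rcases (prob_nonneg p (Z ⁻¹' {z})).eq_or_lt with h0 | h0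
    · rw [← h0, zero_mul]
    · refine mul_eq_zero_of_right _ (Finset.sum_eq_zero fun x _ => Finset.sum_eq_zero fun y _ => ?_)
      rw [← h x y z h0]
      -- The argument of the logarithm is `1` or `0 / 0 = 0`.
      rcases eq_or_ne (condProb p (X ⁻¹' {x} ∩ Y ⁻¹' {y}) (Z ⁻¹' {z})) 0 with h1 | h1
      · rw [h1, zero_mul]
      · rw [div_self h1, Real.log_one, mul_zero]

lemma mutualInfo_eq_sum (p : PMF Ω) (X : Ω → A) (Y : Ω → B) :
    mutualInfo p X Y = ∑ ω, (p ω).toReal *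
      Real.log (prob p (X ⁻¹' {X ω} ∩ Y ⁻¹' {Y ω}) /
        (prob p (X ⁻¹' {X ω}) * prob p (Y ⁻¹' {Y ω}))) := by
  rw [← sum_prob_mul p (fun ω => (X ω, Y ω)) fun a =>
      Real.log (prob p (X ⁻¹' {a.1} ∩ Y ⁻¹' {a.2}) /
        (prob p (X ⁻¹' {a.1}) * prob p (Y ⁻¹' {a.2}))),
    Fintype.sum_prod_type, mutualInfo]
  refine Finset.sum_congr rfl fun x _ => Finset.sum_congr rfl fun y _ => ?_
  congr 2
  ext ω
  simp [Prod.ext_iff]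

/-- The conditional mutual information as an expectation over the sample space, which makes the chain
rule a pointwise identity of logarithms. -/
lemma condMutualInfo_eq_sum (p : PMF Ω) (X : Ω → A) (Y : Ω → B) (Z : Ω → D) :
    condMutualInfo p X Y Z = ∑ ω, (p ω).toReal *
      Real.log (condProb p (X ⁻¹' {X ω} ∩ Y ⁻¹' {Y ω}) (Z ⁻¹' {Z ω}) /
        (condProb p (X ⁻¹' {X ω}) (Z ⁻¹' {Z ω}) *
          condProb p (Y ⁻¹' {Y ω}) (Z ⁻¹' {Z ω}))) := by
  rw [← sum_prob_mul p (fun ω => (Z ω, X ω, Y ω)) fun a =>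
      Real.log (condProb p (X ⁻¹' {a.2.1} ∩ Y ⁻¹' {a.2.2}) (Z ⁻¹' {a.1}) /
        (condProb p (X ⁻¹' {a.2.1}) (Z ⁻¹' {a.1}) *
          condProb p (Y ⁻¹' {a.2.2}) (Z ⁻¹' {a.1}))),
    Fintype.sum_prod_type, condMutualInfo]
  refine Finset.sum_congr rfl fun z _ => ?_
  rw [Fintype.sum_prod_type, Finset.mul_sum]
  refine Finset.sum_congr rfl fun x _ => ?_
  rw [Finset.mul_sum]
  refine Finset.sum_congr rfl fun y _ => ?_
  rw [← mul_assoc]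
  congr 1
  have e : (fun ω => (Z ω, X ω, Y ω)) ⁻¹' {(z, x, y)} =
      X ⁻¹' {x} ∩ Y ⁻¹' {y} ∩ Z ⁻¹' {z} := by
    ext ω
    simp [Prod.ext_iff, and_comm]
  rw [e, condProb]
  rcases eq_or_ne (prob p (Z ⁻¹' {z})) 0 with h | h
  · rw [h, zero_mul]
    exact le_antisymm (prob_nonneg _ _) (h ▸ prob_mono p Set.inter_subset_right)
  · rw [mul_div_cancel₀ _ h]

end Information

section Features

variable {V : Type*} {α : V → Type*}

lemma restrict_preimage (S : Finset V) (ω : ∀ i, α i) :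
    S.restrict ⁻¹' {S.restrict ω} = {ω' : ∀ i, α i | ∀ i ∈ S, ω' i = ω i} := by
  ext ω'
  simp [funext_iff]

variable [DecidableEq V] [Fintype V] [∀ i, Fintype (α i)]

/-- The chain rule for the mutual information. -/
lemma classInfo_insert (p : PMF (∀ i, α i)) (C X : V) (S : Finset V) :
    classInfo p C (insert X S) = classInfo p C S + relevance p C X S := by
  rw [classInfo, classInfo, relevance, mutualInfo_eq_sum, mutualInfo_eq_sum, condMutualInfo_eq_sum,
    ← Finset.sum_add_distrib]
  refine Finset.sum_congr rfl fun ω _ => ?_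
  rw [← mul_add]
  rcases (ENNReal.toReal_nonneg (a := p ω)).eq_or_lt with h0 | h0
  · rw [← h0, zero_mul, zero_mul]
  congr 1
  have hins : (insert X S).restrict ⁻¹' {(insert X S).restrict ω} =
      (fun ω' : ∀ i, α i => ω' X) ⁻¹' {ω X} ∩ S.restrict ⁻¹' {S.restrict ω} := by
    rw [restrict_preimage, restrict_preimage]
    ext ω'
    simp
  rw [hins]
  simp only [condProb]
  set EX : Set (∀ i, α i) := (fun ω' : ∀ i, α i => ω' X) ⁻¹' {ω X}
  set EC : Set (∀ i, α i) := (fun ω' : ∀ i, α i => ω' C) ⁻¹' {ω C}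
  set ES : Set (∀ i, α i) := S.restrict ⁻¹' {S.restrict ω}
  have hX : ω ∈ EX := rfl
  have hC : ω ∈ EC := rfl
  have hS : ω ∈ ES := rfl
  have e : EC ∩ (EX ∩ ES) = EX ∩ EC ∩ ES := by rw [Set.inter_left_comm, Set.inter_assoc]
  rw [e]
  have h1 := prob_pos_of_mem p h0 (E := EX ∩ EC ∩ ES) ⟨⟨hX, hC⟩, hS⟩
  have h2 := prob_pos_of_mem p h0 (E := EX ∩ ES) ⟨hX, hS⟩
  have h3 := prob_pos_of_mem p h0 (E := EC ∩ ES) ⟨hC, hS⟩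
  have h4 := prob_pos_of_mem p h0 hC
  have h5 := prob_pos_of_mem p h0 hS
  rw [← Real.log_mul (by positivity) (by positivity)]
  congr 1
  field_simp

lemma relevance_nonneg (p : PMF (∀ i, α i)) (C X : V) (S : Finset V) : 0 ≤ relevance p C X S :=
  condMutualInfo_nonneg _ _ _ _

lemma relevance_eq_zero_iff (p : PMF (∀ i, α i)) (C X : V) (S : Finset V) :
    relevance p C X S = 0 ↔ CondIndep p (fun ω => ω X) (fun ω => ω C) S.restrict :=
  condMutualInfo_eq_zero_iff _ _ _ _

end Features

/-! ### Factorization of a Bayesian network and the Markov blanket -/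

section Blanket

variable {V : Type*} {α : V → Type*}

lemma IsAcyclic.ne {G : Digraph V} (h : IsAcyclic G) {u v : V} (huv : G.Adj u v) : u ≠ v := by
  rintro rfl
  exact h _ (.single huv)

/-- The event that the variables in `S` have the same values as in `ω`. -/
def cylinder (S : Finset V) (ω : ∀ i, α i) : Set (∀ i, α i) := {ω' | ∀ i ∈ S, ω' i = ω i}

lemma cylinder_congr {S : Finset V} {ω ω' : ∀ i, α i} (h : ∀ i ∈ S, ω i = ω' i) :
    cylinder S ω = cylinder S ω' := by
  ext η
  exact forall₂_congr fun i hi => by rw [h i hi]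

variable [Fintype V]

lemma mem_parents {G : Digraph V} {u v : V} : u ∈ parents G v ↔ G.Adj u v := by
  simp [parents]

lemma mem_markovBlanket {G : Digraph V} {C v : V} : v ∈ markovBlanket G C ↔
    v ≠ C ∧ (G.Adj v C ∨ G.Adj C v ∨ ∃ w, G.Adj C w ∧ G.Adj v w) := by
  simp [markovBlanket]

lemma not_mem_markovBlanket_self (G : Digraph V) (C : V) : C ∉ markovBlanket G C :=
  fun h => (mem_markovBlanket.1 h).1 rfl

/-- A nonempty finite set of nodes of an acyclic graph has a node without children in the set. -/
lemma IsAcyclic.exists_sink {G : Digraph V} (h : IsAcyclic G) {A : Finset V} (hA : A.Nonempty) :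
    ∃ v ∈ A, ∀ w ∈ A, ¬ G.Adj v w := by
  have : IsTrans V (Function.swap (Relation.TransGen G.Adj)) := ⟨fun _ _ _ h1 h2 => h2.trans h1⟩
  have : Std.Irrefl (Function.swap (Relation.TransGen G.Adj)) := ⟨h⟩
  have wf := Finite.wellFounded_of_trans_of_irrefl (Function.swap (Relation.TransGen G.Adj))
  obtain ⟨v, hv, hmin⟩ := wf.has_min (A : Set V) hA
  exact ⟨v, hv, fun w hw hvw => hmin w hw (.single hvw)⟩

/-- The conditional probability `P(v = ω v | parents of v)` at the values of the parents in `ω`. -/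
noncomputable def localFactor (G : Digraph V) (p : PMF (∀ i, α i)) (v : V) (ω : ∀ i, α i) : ℝ :=
  condProb p ((fun ω' => ω' v) ⁻¹' {ω v}) (cylinder (parents G v) ω)

lemma localFactor_congr (G : Digraph V) (p : PMF (∀ i, α i)) {v : V} {ω ω' : ∀ i, α i}
    (hv : ω v = ω' v) (h : ∀ u, G.Adj u v → ω u = ω' u) :
    localFactor G p v ω = localFactor G p v ω' := by
  rw [localFactor, localFactor, hv, cylinder_congr fun u hu => h u (mem_parents.1 hu)]

/-- The marginal distribution of an ancestral set of variables is the product of the local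
conditional distributions. -/
lemma prob_cylinder_eq_prod {G : Digraph V} {p : PMF (∀ i, α i)} (hBN : IsBayesianNetwork G p)
    (A : Finset V) (hA : ∀ v ∈ A, ∀ u, G.Adj u v → u ∈ A) (ω : ∀ i, α i) :
    prob p (cylinder A ω) = ∏ v ∈ A, localFactor G p v ω := by
  classical
  induction hn : A.card generalizing A with
  | zero =>
    obtain rfl := Finset.card_eq_zero.1 hn
    have : cylinder ∅ ω = Set.univ := by ext; simp [cylinder]
    rw [this, prob_univ, Finset.prod_empty]
  | succ n ih =>
    obtain ⟨v, hv, hsink⟩ := hBN.acyclic.exists_sink (Finset.card_pos.1 (by omega : 0 < A.card))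
    have hpar : parents G v ⊆ A.erase v := fun u hu => by
      rw [mem_parents] at hu
      exact Finset.mem_erase.2 ⟨hBN.acyclic.ne hu, hA v hv u hu⟩
    have hanc : ∀ {u w}, Relation.TransGen G.Adj u w → w ∈ A → u ∈ A := fun h hw => by
      induction h using Relation.TransGen.head_induction_on with
      | single h => exact hA _ hw _ h
      | head h _ ih => exact hA _ ih _ h
    have hdesc : ∀ w ∈ A.erase v, w ≠ v ∧ ¬ IsDescendant G v w := fun w hw => by
      refine ⟨Finset.ne_of_mem_erase hw, fun hd => ?_⟩
      have hwA := Finset.mem_of_mem_erase hw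
      rcases Relation.TransGen.head'_iff.1 hd with ⟨u, hu, hr⟩
      rcases Relation.reflTransGen_iff_eq_or_transGen.1 hr with rfl | hr
      exacts [hsink _ hwA hu, hsink _ (hanc hr hwA) hu]
    have hrec := ih (A.erase v) (fun x hx u hu => by
      refine Finset.mem_erase.2 ⟨?_, hA x (Finset.mem_of_mem_erase hx) u hu⟩
      rintro rfl
      exact hsink x (Finset.mem_of_mem_erase hx) hu) (by rw [Finset.card_erase_of_mem hv]; omega)
    rw [← Finset.mul_prod_erase A _ hv, ← hrec]
    have hsub : cylinder (A.erase v) ω ⊆ cylinder (parents G v) ω :=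
      fun η hη i hi => hη i (hpar hi)
    have hcyl : cylinder A ω = (fun ω' => ω' v) ⁻¹' {ω v} ∩ cylinder (A.erase v) ω := by
      ext η
      constructor
      · exact fun h => ⟨h v hv, fun i hi => h i (Finset.mem_of_mem_erase hi)⟩
      · rintro ⟨h1, h2⟩ i hi
        rcases eq_or_ne i v with rfl | hne
        exacts [h1, h2 i (Finset.mem_erase.2 ⟨hne, hi⟩)]
    rcases (prob_nonneg p (cylinder (parents G v) ω)).eq_or_lt with h0 | h0
    · have hz : prob p (cylinder (A.erase v) ω) = 0 :=
        le_antisymm (h0 ▸ prob_mono p hsub) (prob_nonneg _ _)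
      rw [hz, mul_zero]
      exact le_antisymm (hz ▸ prob_mono p (hcyl ▸ Set.inter_subset_right)) (prob_nonneg _ _)
    · have := hBN.markov v (A.erase v) hdesc (ω v) ((A.erase v).restrict ω)
        ((parents G v).restrict ω)
      rw [restrict_preimage, restrict_preimage] at this
      change 0 < prob p (cylinder (parents G v) ω) →
        condProb p ((fun ω' => ω' v) ⁻¹' {ω v} ∩ cylinder (A.erase v) ω)
          (cylinder (parents G v) ω) = localFactor G p v ω *
          condProb p (cylinder (A.erase v) ω) (cylinder (parents G v) ω) at this
      have h := this h0
      rw [← hcyl, condProb, condProb, Set.inter_eq_left.2 hsub, Set.inter_eq_left.2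
        (hcyl ▸ Set.inter_subset_right.trans hsub), ← mul_div_assoc] at h
      exact (div_left_inj' h0.ne').1 h

variable [DecidableEq V] [∀ i, Fintype (α i)]

open Classical in
/-- If the joint distribution is a product `f * g` in which `g` does not depend on the variable `C`
and, on the event `H`, `f` depends only on `C`, then `H ∩ {C = c}` has a probability in product
form. -/
lemma prob_inter_eq_mul (p : PMF (∀ i, α i)) (C : V) (f g : (∀ i, α i) → ℝ)
    (hp : ∀ ω, (p ω).toReal = f ω * g ω) (hg : ∀ ω c, g (Function.update ω C c) = g ω)
    (φ : α C → ℝ) (H : Set (∀ i, α i)) (hH : ∀ ω c, Function.update ω C c ∈ H ↔ ω ∈ H)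
    (hf : ∀ ω ∈ H, f ω = φ (ω C)) (c₀ c : α C) :
    prob p ((fun ω => ω C) ⁻¹' {c} ∩ H) =
      φ c * ∑ ω, if ω C = c₀ ∧ ω ∈ H then g ω else 0 := by
  have e : prob p ((fun ω => ω C) ⁻¹' {c} ∩ H) = ∑ ω with ω C = c ∧ ω ∈ H, (p ω).toReal := by
    rw [prob_eq_sum, Finset.sum_filter]
    congr!
  rw [e, ← Finset.sum_filter, Finset.mul_sum]
  refine Finset.sum_nbij' (fun ω => Function.update ω C c₀) (fun ω => Function.update ω C c)
    ?_ ?_ ?_ ?_ ?_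
  · intro ω h
    simp only [Finset.mem_filter, Finset.mem_univ, true_and] at h ⊢
    exact ⟨by simp, (hH _ _).2 h.2⟩
  · intro ω h
    simp only [Finset.mem_filter, Finset.mem_univ, true_and] at h ⊢
    exact ⟨by simp, (hH _ _).2 h.2⟩
  · intro ω h
    simp only [Finset.mem_filter, Finset.mem_univ, true_and] at h
    rw [Function.update_idem, ← h.1, Function.update_eq_self]
  · intro ω h
    simp only [Finset.mem_filter, Finset.mem_univ, true_and] at h
    rw [Function.update_idem, ← h.1, Function.update_eq_self]
  · intro ω h
    simp only [Finset.mem_filter, Finset.mem_univ, true_and] at h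
    rw [hg, hp, hf ω h.2, h.1]

/-- A product form for the joint distribution as in `prob_inter_eq_mul` gives conditional
independence. -/
lemma condIndep_of_mul (p : PMF (∀ i, α i)) (C Y : V) (S : Finset V) (hC : C ∉ S) (hY : Y ≠ C)
    (f g : (∀ i, α i) → ℝ) (hp : ∀ ω, (p ω).toReal = f ω * g ω)
    (hg : ∀ ω c, g (Function.update ω C c) = g ω)
    (hf : ∀ ω ω', ω C = ω' C → (∀ i ∈ S, ω i = ω' i) → f ω = f ω') :
    CondIndep p (fun ω => ω Y) (fun ω => ω C) S.restrict := by
  classical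
  intro y c z hz
  obtain ⟨ω₀, rfl⟩ : ∃ ω₀ : ∀ i, α i, S.restrict ω₀ = z := by
    by_contra hne
    push Not at hne
    have : S.restrict ⁻¹' {z} = (∅ : Set (∀ i, α i)) := by
      ext ω; simpa using hne ω
    rw [this] at hz
    simp [prob] at hz
  set H : Set (∀ i, α i) := S.restrict ⁻¹' {S.restrict ω₀} with hHdef
  set EY : Set (∀ i, α i) := (fun ω => ω Y) ⁻¹' {y} with hEY
  have hφ : ∀ ω ∈ H, f ω = f (Function.update ω₀ C (ω C)) := fun ω hω => by
    rw [hHdef, restrict_preimage] at hω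
    refine hf _ _ (by simp) fun i hi => ?_
    rw [hω i hi, Function.update_of_ne (ne_of_mem_of_not_mem hi hC)]
  have hH : ∀ ω c, Function.update ω C c ∈ H ↔ ω ∈ H := fun ω c => by
    rw [hHdef, restrict_preimage]
    exact forall₂_congr fun i hi => by
      rw [Function.update_of_ne (ne_of_mem_of_not_mem hi hC)]
  have hYH : ∀ ω c, Function.update ω C c ∈ EY ∩ H ↔ ω ∈ EY ∩ H := fun ω c => by
    rw [Set.mem_inter_iff, Set.mem_inter_iff, hH, hEY]
    simp only [Set.mem_preimage, Function.update_of_ne hY]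
  have h1 := prob_inter_eq_mul p C f g hp hg (fun c => f (Function.update ω₀ C c)) H hH hφ (ω₀ C)
  have h2 := prob_inter_eq_mul p C f g hp hg (fun c => f (Function.update ω₀ C c)) (EY ∩ H) hYH
    (fun ω hω => hφ ω hω.2) (ω₀ C)
  have h3 := sum_prob_inter p (fun ω => ω C) H
  have h4 := sum_prob_inter p (fun ω => ω C) (EY ∩ H)
  simp only [h1, ← Finset.sum_mul] at h3
  simp only [h2, ← Finset.sum_mul] at h4
  have hne := hz.ne'
  rw [condProb, condProb, condProb, Set.inter_comm EY, Set.inter_assoc, h1, h2, ← h4]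
  rw [← h3] at hne ⊢
  field_simp

/-- The Markov blanket of `C` shields it from the other variables: `C` is independent of every
other variable given any set of features that contains the blanket. -/
lemma IsBayesianNetwork.condIndep_of_markovBlanket_subset {G : Digraph V} {p : PMF (∀ i, α i)}
    (hBN : IsBayesianNetwork G p) {C Y : V} {S : Finset V} (hMB : markovBlanket G C ⊆ S)
    (hC : C ∉ S) (hY : Y ≠ C) : CondIndep p (fun ω => ω Y) (fun ω => ω C) S.restrict := by
  classical
  -- `f` collects the local factors in which `C` occurs, at `C` and at its children.
  refine condIndep_of_mul p C Y S hC hY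
    (fun ω => ∏ v with v = C ∨ G.Adj C v, localFactor G p v ω)
    (fun ω => ∏ v with ¬ (v = C ∨ G.Adj C v), localFactor G p v ω) ?_ ?_ ?_
  · intro ω
    rw [Finset.prod_filter_mul_prod_filter_not,
      ← prob_cylinder_eq_prod hBN Finset.univ (fun _ _ _ _ => Finset.mem_univ _)]
    have : cylinder Finset.univ ω = {ω} := by
      ext η; simp [cylinder, funext_iff]
    rw [this, prob, PMF.toOuterMeasure_apply_singleton]
  · intro ω c
    refine Finset.prod_congr rfl fun v hv => ?_
    simp only [Finset.mem_filter, Finset.mem_univ, true_and, not_or] at hv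
    refine localFactor_congr G p (Function.update_of_ne hv.1 _ _) fun u hu =>
      Function.update_of_ne ?_ _ _
    rintro rfl
    exact hv.2 hu
  · intro ω ω' hωC hωS
    refine Finset.prod_congr rfl fun v hv => ?_
    simp only [Finset.mem_filter, Finset.mem_univ, true_and] at hv
    have key : ∀ u, (u ≠ C → u ∈ markovBlanket G C) → ω u = ω' u := fun u hu => by
      rcases eq_or_ne u C with rfl | hne
      exacts [hωC, hωS u (hMB (hu hne))]
    refine localFactor_congr G p (key v fun hne => ?_) fun u hu => key u fun hne => ?_
    · exact mem_markovBlanket.2 ⟨hne, .inr (.inl (hv.resolve_left hne))⟩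
    · rcases hv with rfl | hv
      · exact mem_markovBlanket.2 ⟨hne, .inl hu⟩
      · exact mem_markovBlanket.2 ⟨hne, .inr (.inr ⟨v, hv, hu⟩)⟩

end Blanket

/-! ### Binary models refuting independence from a member of the Markov blanket -/

section BitModels

/-- Two independent fair bits. -/
noncomputable def fairBits : PMF (Bool × Bool) := PMF.uniformOfFintype _

open Classical in
lemma prob_fairBits (E : Set (Bool × Bool)) : prob fairBits E =
    ((if (true, true) ∈ E then 1 else 0) + (if (true, false) ∈ E then 1 else 0) +
      (if (false, true) ∈ E then 1 else 0) + (if (false, false) ∈ E then 1 else 0)) / 4 := by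
  have h : ∀ b, (fairBits b).toReal = 1 / 4 := fun b => by
    rw [fairBits, PMF.uniformOfFintype_apply]
    norm_num
  rw [prob_eq_sum, Fintype.sum_prod_type]
  simp only [h, Fintype.sum_bool]
  split_ifs <;> norm_num

lemma prob_fairBits_fst_inter (x : Bool) (F : Set (Bool × Bool))
    (hF : ∀ a a' b, (a, b) ∈ F → (a', b) ∈ F) :
    prob fairBits (Prod.fst ⁻¹' {x} ∩ F) = prob fairBits F / 2 := by
  classical
  have h : ∀ b, (false, b) ∈ F ↔ (true, b) ∈ F := fun b => ⟨hF _ _ _, hF _ _ _⟩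
  rw [prob_fairBits, prob_fairBits]
  cases x <;> by_cases h1 : (true, true) ∈ F <;> by_cases h2 : (true, false) ∈ F <;>
    simp [h, h1, h2] <;> norm_num

lemma prob_fairBits_snd_inter (x : Bool) (F : Set (Bool × Bool))
    (hF : ∀ a b b', (a, b) ∈ F → (a, b') ∈ F) :
    prob fairBits (Prod.snd ⁻¹' {x} ∩ F) = prob fairBits F / 2 := by
  classical
  have h : ∀ a, (a, false) ∈ F ↔ (a, true) ∈ F := fun b => ⟨hF _ _ _, hF _ _ _⟩
  rw [prob_fairBits, prob_fairBits]
  cases x <;> by_cases h1 : (true, true) ∈ F <;> by_cases h2 : (false, true) ∈ F <;>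
    simp [h, h1, h2] <;> norm_num

/-- If `X` is unconditionally independent of the pair `(Y, Z)`, then it is independent of `Y`
given `Z`. -/
lemma condIndep_of_prob_inter {Ω A B D : Type*} (p : PMF Ω) (X : Ω → A) (Y : Ω → B) (Z : Ω → D)
    (r : A → ℝ) (hYZ : ∀ x y z, prob p (X ⁻¹' {x} ∩ (Y ⁻¹' {y} ∩ Z ⁻¹' {z})) =
      r x * prob p (Y ⁻¹' {y} ∩ Z ⁻¹' {z}))
    (hZ : ∀ x z, prob p (X ⁻¹' {x} ∩ Z ⁻¹' {z}) = r x * prob p (Z ⁻¹' {z})) :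
    CondIndep p X Y Z := by
  intro x y z hz
  rw [condProb, condProb, condProb, Set.inter_assoc, hYZ, hZ]
  field_simp

variable {V : Type*} [Fintype V]

/-- A network of bits computed from two fair bits satisfies the Markov condition if each node is
a function of its parents, or is one of the fair bits while its non-descendants are functions of
the other one. -/
lemma markovCondition_map_fairBits {G : Digraph V} (hG : IsAcyclic G)
    (f : Bool × Bool → V → Bool)
    (h : ∀ v, (∀ b b', (∀ u, G.Adj u v → f b u = f b' u) → f b v = f b' v) ∨
      ((∀ b, f b v = b.1) ∧
        ∀ u, u ≠ v → ¬ IsDescendant G v u → ∀ a a' b, f (a, b) u = f (a', b) u) ∨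
      ((∀ b, f b v = b.2) ∧
        ∀ u, u ≠ v → ¬ IsDescendant G v u → ∀ a b b', f (a, b) u = f (a, b') u)) :
    MarkovCondition (α := fun _ => Bool) G (fairBits.map f) := by
  intro v T hT
  rw [condIndep_map]
  have hpar : ∀ u ∈ parents G v, u ≠ v ∧ ¬ IsDescendant G v u := fun u hu => by
    rw [mem_parents] at hu
    exact ⟨hG.ne hu, fun hd => hG v (hd.tail hu)⟩
  rcases h v with h | ⟨hv, h⟩ | ⟨hv, h⟩
  · refine condIndep_of_factorsThrough _ _ _ _ fun b b' hb => h b b' fun u hu => ?_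
    exact congrFun hb ⟨u, mem_parents.2 hu⟩
  · have hX : (fun ω : V → Bool => ω v) ∘ f = Prod.fst := funext hv
    have inv : ∀ U : Finset V, (∀ u ∈ U, u ≠ v ∧ ¬ IsDescendant G v u) → ∀ y a a' b,
        (a, b) ∈ (U.restrict ∘ f) ⁻¹' {y} → (a', b) ∈ (U.restrict ∘ f) ⁻¹' {y} :=
      fun U hU y a a' b hab => by
        have : U.restrict (f (a', b)) = U.restrict (f (a, b)) :=
          funext fun u => h u (hU u u.2).1 (hU u u.2).2 _ _ _
        exact this.trans hab
    rw [hX]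
    refine condIndep_of_prob_inter _ _ _ _ (fun _ => 1 / 2) (fun x y z => ?_) fun x z => ?_
    · rw [prob_fairBits_fst_inter]
      · ring
      · exact fun a a' b hab => ⟨inv T hT y a a' b hab.1, inv _ hpar z a a' b hab.2⟩
    · rw [prob_fairBits_fst_inter]
      · ring
      · exact inv _ hpar z
  · have hX : (fun ω : V → Bool => ω v) ∘ f = Prod.snd := funext hv
    have inv : ∀ U : Finset V, (∀ u ∈ U, u ≠ v ∧ ¬ IsDescendant G v u) → ∀ y a b b',
        (a, b) ∈ (U.restrict ∘ f) ⁻¹' {y} → (a, b') ∈ (U.restrict ∘ f) ⁻¹' {y} :=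
      fun U hU y a b b' hab => by
        have : U.restrict (f (a, b')) = U.restrict (f (a, b)) :=
          funext fun u => h u (hU u u.2).1 (hU u u.2).2 _ _ _
        exact this.trans hab
    rw [hX]
    refine condIndep_of_prob_inter _ _ _ _ (fun _ => 1 / 2) (fun x y z => ?_) fun x z => ?_
    · rw [prob_fairBits_snd_inter]
      · ring
      · exact fun a b b' hab => ⟨inv T hT y a b b' hab.1, inv _ hpar z a b b' hab.2⟩
    · rw [prob_fairBits_snd_inter]
      · ring
      · exact inv _ hpar z

variable [DecidableEq V]

/-- Adjacent nodes are not entailed to be independent: in the model where the head of the edge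
copies a fair bit at its tail, and the other variables are constant, they are dependent. -/
lemma not_entailed_of_adj {G : Digraph V} (hG : IsAcyclic G) {u w : V} (huw : G.Adj u w)
    {S : Finset V} (hu : u ∉ S) (hw : w ∉ S) : ¬ Entailed G u w S := by
  classical
  intro hent
  set f : Bool × Bool → V → Bool := fun b v => if v = u ∨ v = w then b.1 else true with hf
  have hM : MarkovCondition (α := fun _ => Bool) G (fairBits.map f) := by
    refine markovCondition_map_fairBits hG f fun v => ?_
    by_cases hvw : v = w
    · subst hvw
      exact .inl fun b b' h => by simpa [hf] using h u huw
    by_cases hvu : v = u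
    · subst hvu
      refine .inr (.inl ⟨fun b => by simp [hf], fun x hx hd a a' b => ?_⟩)
      have hxw : x ≠ w := by rintro rfl; exact hd (.single huw)
      simp [hf, hx, hxw]
    · exact .inl fun b b' _ => by simp [hf, hvu, hvw]
  have h := hent (fun _ => Bool) (fairBits.map f) hM
  rw [condIndep_map] at h
  have h1 := h true true (S.restrict (f (true, true)))
  have hX : (fun ω : V → Bool => ω u) ∘ f = Prod.fst := by ext b; simp [hf]
  have hY : (fun ω : V → Bool => ω w) ∘ f = Prod.fst := by ext b; simp [hf]
  have hZ : (S.restrict ∘ f) ⁻¹' {S.restrict (f (true, true))} = Set.univ := by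
    ext b
    simp only [Set.mem_preimage, Set.mem_singleton_iff, Set.mem_univ, iff_true]
    funext i
    have h1 : (i : V) ≠ u := ne_of_mem_of_not_mem i.2 hu
    have h2 : (i : V) ≠ w := ne_of_mem_of_not_mem i.2 hw
    simp [hf, h1, h2]
  rw [hX, hY, hZ] at h1
  simp [condProb, prob_fairBits] at h1
  norm_num at h1

/-- The parents of a common child `w` are not entailed to be independent given a set that contains
`w`: in the model where the parents are independent fair bits, `w` is their sum modulo `2`, and the
other variables are constant, they are dependent given `w`. -/
lemma not_entailed_of_common_child {G : Digraph V} (hG : IsAcyclic G) {u c w : V} (huc : u ≠ c)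
    (huw : G.Adj u w) (hcw : G.Adj c w) {S : Finset V} (hu : u ∉ S) (hc : c ∉ S) (hw : w ∈ S) :
    ¬ Entailed G u c S := by
  classical
  intro hent
  have hwu := (hG.ne huw).symm
  have hwc := (hG.ne hcw).symm
  set f : Bool × Bool → V → Bool := fun b v =>
    if v = u then b.1 else if v = c then b.2 else if v = w then xor b.1 b.2 else true with hf
  have hM : MarkovCondition (α := fun _ => Bool) G (fairBits.map f) := by
    refine markovCondition_map_fairBits hG f fun v => ?_
    by_cases hvw : v = w
    · subst hvw
      refine .inl fun b b' h => ?_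
      have h1 : b.1 = b'.1 := by simpa [hf] using h u huw
      have h2 : b.2 = b'.2 := by simpa [hf, huc.symm] using h c hcw
      simp [hf, h1, h2]
    by_cases hvu : v = u
    · subst hvu
      refine .inr (.inl ⟨fun b => by simp [hf], fun x hx hd a a' b => ?_⟩)
      have hxw : x ≠ w := by rintro rfl; exact hd (.single huw)
      simp [hf, hx, hxw]
    by_cases hvc : v = c
    · subst hvc
      refine .inr (.inr ⟨fun b => by simp [hf, hvu], fun x hx hd a b b' => ?_⟩)
      have hxw : x ≠ w := by rintro rfl; exact hd (.single hcw)
      simp [hf, hx, hxw]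
    · exact .inl fun b b' _ => by simp [hf, hvu, hvw, hvc]
  have h := hent (fun _ => Bool) (fairBits.map f) hM
  rw [condIndep_map] at h
  have h1 := h true true (S.restrict (f (true, true)))
  have hX : (fun ω : V → Bool => ω u) ∘ f = Prod.fst := by ext b; simp [hf]
  have hY : (fun ω : V → Bool => ω c) ∘ f = Prod.snd := by ext b; simp [hf, huc.symm]
  have hZ : (S.restrict ∘ f) ⁻¹' {S.restrict (f (true, true))} = {b | b.1 = b.2} := by
    ext b
    simp only [Set.mem_preimage, Set.mem_singleton_iff, Set.mem_ofPred_eq]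
    constructor
    · intro hb
      have := congrFun hb ⟨w, hw⟩
      simpa [hf, hwu, hwc] using this
    · intro hb
      funext i
      have h1 : (i : V) ≠ u := ne_of_mem_of_not_mem i.2 hu
      have h2 : (i : V) ≠ c := ne_of_mem_of_not_mem i.2 hc
      simp [hf, h1, h2, hb]
  rw [hX, hY, hZ] at h1
  simp [condProb, prob_fairBits] at h1
  norm_num at h1

end BitModels

/-! ### Correctness of Inter-IAMB -/

section Algorithm

variable {V : Type*} [DecidableEq V] {α : V → Type*} [∀ i, Fintype (α i)]

lemma InterIAMBReachable.class_not_mem {p : PMF (∀ i, α i)} {C : V} {s : Phase × Finset V}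
    (h : InterIAMBReachable p C s) : C ∉ s.2 := by
  induction h with
  | refl => simp [interIAMBStart]
  | tail _ hstep ih =>
    cases hstep with
    | add S X hXC _ _ _ => simpa [hXC.symm] using ih
    | remove S Y _ _ => exact fun h => ih (Finset.mem_of_mem_erase h)
    | resume S _ => exact ih

/-- Whenever the forward phase begins, no selected feature is redundant. -/
lemma InterIAMBReachable.relevance_pos {p : PMF (∀ i, α i)} {C : V} {S : Finset V}
    (h : InterIAMBReachable p C (Phase.forward, S)) : ∀ Y ∈ S, 0 < relevance p C Y (S.erase Y) := by
  rcases Relation.ReflTransGen.cases_tail h with h | ⟨s, _, hstep⟩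
  · obtain ⟨-, rfl⟩ := Prod.mk.inj h
    simp
  · cases hstep with
    | resume _ hpos => exact hpos

variable [Fintype V]

/-- In a faithful network, a set of features outside of which no feature is relevant contains the
Markov blanket. Parents and children of `C` are in `S` because edges are never separated; a spouse
is in `S` because the common child already is. -/
lemma markovBlanket_subset_of_relevance_eq_zero {G : Digraph V} {p : PMF (∀ i, α i)} {C : V}
    (hG : IsAcyclic G) (hfaith : Faithful G p) {S : Finset V} (hC : C ∉ S)
    (h : ∀ X, X ≠ C → X ∉ S → relevance p C X S = 0) : markovBlanket G C ⊆ S := by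
  have ent : ∀ X, X ≠ C → X ∉ S → Entailed G X C S ∧ Entailed G C X S := fun X hXC hXS => by
    have hci := (relevance_eq_zero_iff p C X S).1 (h X hXC hXS)
    exact ⟨hfaith X C S hXC hXS hC hci, hfaith C X S hXC.symm hC hXS hci.symm⟩
  have hchild : ∀ w, G.Adj C w → w ∈ S := fun w hw => by
    by_contra hwS
    exact not_entailed_of_adj hG hw hC hwS (ent w (hG.ne hw).symm hwS).2
  intro X hX
  rw [mem_markovBlanket] at hX
  obtain ⟨hXC, hX | hX | ⟨w, hCw, hXw⟩⟩ := hX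
  · by_contra hXS
    exact not_entailed_of_adj hG hX hXS hC (ent X hXC hXS).1
  · exact hchild X hX
  · by_contra hXS
    exact not_entailed_of_common_child hG hXC hXw hCw hXS hC (hchild w hCw) (ent X hXC hXS).1

lemma classInfo_le_union (p : PMF (∀ i, α i)) (C : V) (S T : Finset V) :
    classInfo p C S ≤ classInfo p C (S ∪ T) := by
  induction T using Finset.induction_on with
  | empty => rw [Finset.union_empty]
  | insert X T _ ih =>
    rw [Finset.union_insert, classInfo_insert]
    exact ih.trans (le_add_of_nonneg_right (relevance_nonneg _ _ _ _))

lemma classInfo_mono (p : PMF (∀ i, α i)) (C : V) {S T : Finset V} (h : S ⊆ T) :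
    classInfo p C S ≤ classInfo p C T := by
  simpa only [Finset.union_eq_right.2 h] using classInfo_le_union p C S T

lemma relevance_eq_zero_of_markovBlanket_subset {G : Digraph V} {p : PMF (∀ i, α i)}
    (hBN : IsBayesianNetwork G p) {C Y : V} {S : Finset V} (hMB : markovBlanket G C ⊆ S)
    (hC : C ∉ S) (hY : Y ≠ C) : relevance p C Y S = 0 :=
  (relevance_eq_zero_iff p C Y S).2 (hBN.condIndep_of_markovBlanket_subset hMB hC hY)

/-- No set of features carries more information on `C` than the Markov blanket. -/
lemma classInfo_le_markovBlanket {G : Digraph V} {p : PMF (∀ i, α i)}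
    (hBN : IsBayesianNetwork G p) {C : V} {T : Finset V} (hC : C ∉ T) :
    classInfo p C T ≤ classInfo p C (markovBlanket G C) := by
  refine (classInfo_mono p C (Finset.subset_union_right (s₁ := markovBlanket G C))).trans
    (le_of_eq ?_)
  induction T using Finset.induction_on with
  | empty => rw [Finset.union_empty]
  | insert X T _ ih =>
    rw [Finset.mem_insert, not_or] at hC
    rw [Finset.union_insert, classInfo_insert, ih hC.2,
      relevance_eq_zero_of_markovBlanket_subset hBN Finset.subset_union_left
        (by simp [hC.2, not_mem_markovBlanket_self]) (Ne.symm hC.1), add_zero]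

lemma isLeast_optimalSets_markovBlanket {G : Digraph V} {p : PMF (∀ i, α i)} {C : V}
    (hBN : IsBayesianNetwork G p) (hfaith : Faithful G p) :
    IsLeast (optimalSets p C) (markovBlanket G C) := by
  refine ⟨⟨not_mem_markovBlanket_self G C, fun T hT => classInfo_le_markovBlanket hBN hT⟩,
    fun T hT => markovBlanket_subset_of_relevance_eq_zero hBN.acyclic hfaith hT.1
      fun X hXC _ => ?_⟩
  have h := hT.2 (insert X T) (by simp [hXC.symm, hT.1])
  rw [classInfo_insert] at h
  exact le_antisymm (by linarith) (relevance_nonneg _ _ _ _)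

/-- The rank of a phase in the termination order: `resume` passes from the backward to the forward
phase. -/
def Phase.rank : Phase → ℕ
  | .forward => 0
  | .backward => 1

instance : Finite Phase :=
  Finite.of_surjective (fun b : Bool => if b then Phase.forward else Phase.backward) fun
    | .forward => ⟨true, rfl⟩
    | .backward => ⟨false, rfl⟩

/-- The measure that decreases lexicographically along every step of Inter-IAMB: the information
`I(C; S)`, in the reversed order, then the phase, then the number of selected features. -/
noncomputable def runMeasure (p : PMF (∀ i, α i)) (C : V) (s : Phase × Finset V) :
    ℝᵒᵈ ×ₗ ℕ ×ₗ ℕ :=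
  toLex (OrderDual.toDual (classInfo p C s.2), toLex (s.1.rank, s.2.card))

lemma InterIAMBStep.runMeasure_lt {p : PMF (∀ i, α i)} {C : V} {s t : Phase × Finset V}
    (h : InterIAMBStep p C s t) : runMeasure p C t < runMeasure p C s := by
  cases h with
  | add S X hXC hXS hmax hpos =>
    refine Prod.Lex.toLex_lt_toLex.2 (.inl (OrderDual.toDual_lt_toDual.2 ?_))
    change classInfo p C S < classInfo p C (insert X S)
    rw [classInfo_insert]
    exact lt_add_of_pos_right _ hpos
  | remove S Y hY hzero =>
    refine Prod.Lex.toLex_lt_toLex.2 (.inr ⟨?_, Prod.Lex.toLex_lt_toLex.2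
      (.inr ⟨rfl, Finset.card_erase_lt_of_mem hY⟩)⟩)
    have h := classInfo_insert p C Y (S.erase Y)
    rw [Finset.insert_erase hY, hzero, add_zero] at h
    exact congrArg OrderDual.toDual h.symm
  | resume S hpos =>
    exact Prod.Lex.toLex_lt_toLex.2 (.inr ⟨rfl, Prod.Lex.toLex_lt_toLex.2 (.inl zero_lt_one)⟩)

/-- Inter-IAMB has only finitely many states, so its decreasing measure makes it well-founded. -/
lemma wellFounded_interIAMBStep (p : PMF (∀ i, α i)) (C : V) :
    WellFounded (Function.swap (InterIAMBStep p C)) := by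
  have : IsTrans (Phase × Finset V) (InvImage (· < ·) (runMeasure p C)) :=
    ⟨fun _ _ _ h1 h2 => lt_trans (α := ℝᵒᵈ ×ₗ ℕ ×ₗ ℕ) h1 h2⟩
  have : Std.Irrefl (InvImage (· < ·) (runMeasure p C)) :=
    ⟨fun _ => lt_irrefl (α := ℝᵒᵈ ×ₗ ℕ ×ₗ ℕ) _⟩
  exact Subrelation.wf (fun h => InterIAMBStep.runMeasure_lt h)
    (Finite.wellFounded_of_trans_of_irrefl (InvImage (· < ·) (runMeasure p C)))

lemma exists_interIAMBStep (p : PMF (∀ i, α i)) (C : V) (s : Phase × Finset V)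
    (hs : ¬ InterIAMBHalted p C s) : ∃ t, InterIAMBStep p C s t := by
  obtain ⟨φ, S⟩ := s
  cases φ with
  | forward =>
    simp only [InterIAMBHalted, true_and, not_forall] at hs
    obtain ⟨X₀, h1, h2, h3⟩ := hs
    obtain ⟨X, hX, hmax⟩ := Finset.exists_max_image
      (Finset.univ.filter fun X => X ≠ C ∧ X ∉ S) (fun X => relevance p C X S) ⟨X₀, by simp [h1, h2]⟩
    simp only [Finset.mem_filter, Finset.mem_univ, true_and] at hX hmax
    exact ⟨_, .add S X hX.1 hX.2 (fun Y hYC hYS => hmax Y ⟨hYC, hYS⟩)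
      (((relevance_nonneg p C X₀ S).lt_of_ne' h3).trans_le (hmax X₀ ⟨h1, h2⟩))⟩
  | backward =>
    by_cases h : ∃ Y ∈ S, relevance p C Y (S.erase Y) = 0
    · obtain ⟨Y, hY, hzero⟩ := h
      exact ⟨_, .remove S Y hY hzero⟩
    · push Not at h
      exact ⟨_, .resume S fun Y hY => (relevance_nonneg _ _ _ _).lt_of_ne' (h Y hY)⟩

lemma interIAMBTerminates (p : PMF (∀ i, α i)) (C : V) : InterIAMBTerminates p C := by
  refine ⟨?_, fun s _ hs => exists_interIAMBStep p C s hs⟩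
  rintro ⟨run, -, hrun⟩
  exact (wellFounded_iff_isEmpty_descending_chain.1 (wellFounded_interIAMBStep p C)).false
    ⟨run, hrun⟩

lemma InterIAMBOutput.eq_markovBlanket {G : Digraph V} {p : PMF (∀ i, α i)} {C : V}
    (hBN : IsBayesianNetwork G p) (hfaith : Faithful G p) {S : Finset V}
    (h : InterIAMBOutput p C S) : S = markovBlanket G C := by
  obtain ⟨hreach, -, hhalt⟩ := h
  have hC : C ∉ S := hreach.class_not_mem
  have hsub := markovBlanket_subset_of_relevance_eq_zero hBN.acyclic hfaith hC hhalt
  refine Finset.Subset.antisymm (fun Y hY => ?_) hsub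
  by_contra hYM
  refine (hreach.relevance_pos Y hY).ne' (relevance_eq_zero_of_markovBlanket_subset hBN
    (fun X hX => Finset.mem_erase.2 ⟨ne_of_mem_of_not_mem hX hYM, hsub hX⟩)
    (fun h => hC (Finset.mem_of_mem_erase h)) (ne_of_mem_of_not_mem hY hC))

lemma exists_interIAMBOutput (p : PMF (∀ i, α i)) (C : V) : ∃ S, InterIAMBOutput p C S := by
  obtain ⟨⟨φ, S⟩, hreach, hmin⟩ := (wellFounded_interIAMBStep p C).has_min
    {s | InterIAMBReachable p C s} ⟨interIAMBStart, .refl⟩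
  have hhalt : InterIAMBHalted p C (φ, S) := by
    by_contra h
    obtain ⟨t, ht⟩ := exists_interIAMBStep p C _ h
    exact hmin t (Relation.ReflTransGen.tail hreach ht) ht
  obtain rfl : φ = Phase.forward := hhalt.1
  exact ⟨S, hreach, hhalt⟩

end Algorithm

end FeatureSelection

open FeatureSelection in
/-- In a faithful Bayesian network, every run of Inter-IAMB stops, and its output is the Markov
blanket of the class attribute `C`, which maximizes `I(C; S)` over all sets `S` of features and is
contained in every other maximizer. -/
theorem theorem4 {V : Type*} [Fintype V] [DecidableEq V] {α : V → Type*} [∀ i, Fintype (α i)]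
    (G : Digraph V) (p : PMF (∀ i, α i)) (C : V)
    (hBN : IsBayesianNetwork G p) (hfaith : Faithful G p) :
    InterIAMBTerminates p C ∧
    (∀ S : Finset V, InterIAMBOutput p C S ↔ S = markovBlanket G C) ∧
    IsLeast (optimalSets p C) (markovBlanket G C) := by
  refine ⟨interIAMBTerminates p C, fun S => ⟨fun h => h.eq_markovBlanket hBN hfaith, ?_⟩,
    isLeast_optimalSets_markovBlanket hBN hfaith⟩
  rintro rfl
  obtain ⟨S, hS⟩ := exists_interIAMBOutput p C
  exact hS.eq_markovBlanket hBN hfaith ▸ hS
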